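/- Fix an arbitrary first-order signature $L$ (relation, function and constant symbols) and a countably infinite set of variables. A ($k$-ary, $k\in\mathbb N$) \emph{first-order dependency} $\mathbf D$ is a first-order sentence $\mathbf D(R)$ over the signature $\{R\}$, where $R$ is a $k$-ary relation symbol. Let $\mathcal D$ be any family of first-order dependencies. \textbf{Syntax.} The formulas of $\mathrm{FO}(\mathcal D,\Diamond)$ over $L$ are built from first-order literals ($t_1=t_2$, $t_1\neq t_2$, $S\vec t$, $\neg S\vec t$) and dependency atoms $\mathbf D\vec t$ (where $\mathbf D\in\mathcal D$ and $\vec t$ is a tuple of $L$-terms whose length is the arity of $\mathbf D$) by means of $\vee$, $\wedge$, $\exists x$, $\forall x$ and the unary operator $\Diamond$. The formulas of $\mathrm{FO}(\mathcal D)$ are those in which $\Diamond$ does not occur. A sentence is a formula without free variables. \textbf{Semantics.} Let $\mathfrak M$ be an $L$-structure with domain $M$. A team $X$ with finite domain $V$ is a set of assignments $s:V\to M$; for a tuple $\vec t$ of terms with variables in $V$, put $X(\vec t)=\{s(\vec t): s\in X\}$. For formulas whose free variables lie in $V$, the relation $\mathfrak M\models_X\phi$ is defined by: \begin{itemize} \item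 $\mathfrak M\models_X\alpha$, for a literal $\alpha$, iff every $s\in X$ satisfies $\alpha$ in the usual sense; \item $\mathfrak M\models_X\mathbf D\vec t$ iff the structure $(M,X(\vec t))$, in which $R$ is interpreted as $X(\vec t)$, satisfies the sentence $\mathbf D(R)$ in the usual (Tarskian) sense; \item $\mathfrak M\models_X\psi_1\vee\psi_2$ iff $X=Y\cup Z$ for some teams $Y,Z$ with $\mathfrak M\models_Y\psi_1$ and $\mathfrak M\models_Z\psi_2$; \item $\mathfrak M\models_X\psi_1\wedge\psi_2$ iff $\mathfrak M\models_X\psi_1$ and $\mathfrak M\models_X\psi_2$; \item $\mathfrak M\models_X\exists x\,\psi$ iff there is a function $H:X\to\mathcal P(M)\setminus\{\emptyset\}$ such that $\mathfrak M\models_{X[H/x]}\psi$, where $X[H/x]=\{s[m/x]:s\in X,\ m\in H(s)\}$; \item $\mathfrak M\models_X\forall x\,\psi$ iff $\mathfrak M\models_{X[M/x]}\psi$, where $X[M/x]=\{s[m/x]:s\in X,\ m\in M\}$; \item $\mathfrak M\models_X\Diamond\psi$ iff there is a nonempty $Y\subseteq X$ with $\mathfrak M\models_Y\psi$. \end{itemize}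 A sentence $\phi$ is true in $\mathfrak M$ iff $\mathfrak M\models_{\{\epsilon\}}\phi$, where $\epsilon$ is the assignment with empty domain. Two sentences are equivalent if they are true in the same $L$-structures with at least two elements. \textbf{Corollary.} For every family $\mathcal D$ of first-order dependencies, every sentence of $\mathrm{FO}(\mathcal D,\Diamond)$ over $L$ is equivalent to some sentence of $\mathrm{FO}(\mathcal D)$ over $L$. -/

import Mathlib

universe u v w

namespace TeamLogic

open scoped FirstOrder

/-- The only symbol of the signature `{R}`, where `R` is a `k`-ary relation symbol. -/
inductive RelSymbol (k : ℕ) : ℕ → Type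
  | R : RelSymbol k k

/-- The signature `{R}` with a single `k`-ary relation symbol and no function symbols. -/
def relLanguage (k : ℕ) : FirstOrder.Language.{0, 0} where
  Functions := fun _ => Empty
  Relations := RelSymbol k

/-- The structure `(M, S)` of signature `{R}`, in which `R` is interpreted by `S ⊆ M^k`. -/
@[reducible]
def relStructure {M : Type w} {k : ℕ} (S : Set (Fin k → M)) : (relLanguage k).Structure M where
  funMap := fun f => Empty.elim f
  RelMap := fun r =>
    match r with
    | RelSymbol.R => fun x => x ∈ S

/-- A first order dependency `D(R)`: an arity `k` and a first order sentence over `{R}`. -/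
structure Dependency where
  arity : ℕ
  sentence : (relLanguage arity).Sentence

/-- `(M, S) ⊨ D(R)`, in the usual Tarskian semantics. -/
def Dependency.Holds (d : Dependency) {M : Type w} (S : Set (Fin d.arity → M)) : Prop :=
  letI := relStructure S
  M ⊨ d.sentence

/-- The formulas of `FO(D, ◇)` over the signature `L`, in negation normal form,
with variable symbols indexed by `ℕ`. -/
inductive TeamFormula (L : FirstOrder.Language.{u, v}) (D : Set Dependency) : Type (max u v)
  | eq (t₁ t₂ : L.Term ℕ) : TeamFormula L D
  | ne (t₁ t₂ : L.Term ℕ) : TeamFormula L D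
  | rel {n : ℕ} (R : L.Relations n) (t : Fin n → L.Term ℕ) : TeamFormula L D
  | nrel {n : ℕ} (R : L.Relations n) (t : Fin n → L.Term ℕ) : TeamFormula L D
  | dep (d : Dependency) (hd : d ∈ D) (t : Fin d.arity → L.Term ℕ) : TeamFormula L D
  | or (φ ψ : TeamFormula L D) : TeamFormula L D
  | and (φ ψ : TeamFormula L D) : TeamFormula L D
  | ex (x : ℕ) (φ : TeamFormula L D) : TeamFormula L D
  | all (x : ℕ) (φ : TeamFormula L D) : TeamFormula L D
  | dia (φ : TeamFormula L D) : TeamFormula L D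

/-- The set of all variables that occur in a tuple of terms. -/
def tupleVars {L : FirstOrder.Language.{u, v}} {n : ℕ} (t : Fin n → L.Term ℕ) : Finset ℕ :=
  Finset.univ.biUnion fun i => (t i).varFinset

theorem varFinset_subset_tupleVars {L : FirstOrder.Language.{u, v}} {n : ℕ} (t : Fin n → L.Term ℕ)
    (i : Fin n) : (t i).varFinset ⊆ tupleVars t :=
  Finset.subset_biUnion_of_mem (fun i => (t i).varFinset) (Finset.mem_univ i)

/-- The variables that occur free in a formula. -/
def TeamFormula.freeVars {L : FirstOrder.Language.{u, v}} {D : Set Dependency} : TeamFormula L D → Finset ℕ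
  | .eq t₁ t₂ => t₁.varFinset ∪ t₂.varFinset
  | .ne t₁ t₂ => t₁.varFinset ∪ t₂.varFinset
  | .rel _ t => tupleVars t
  | .nrel _ t => tupleVars t
  | .dep _ _ t => tupleVars t
  | .or φ ψ => φ.freeVars ∪ ψ.freeVars
  | .and φ ψ => φ.freeVars ∪ ψ.freeVars
  | .ex x φ => φ.freeVars.erase x
  | .all x φ => φ.freeVars.erase x
  | .dia φ => φ.freeVars

/-- The formulas of `FO(D)`: those formulas of `FO(D, ◇)` in which `◇` does not occur. -/
def TeamFormula.DiamondFree {L : FirstOrder.Language.{u, v}} {D : Set Dependency} : TeamFormula L D → Prop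
  | .eq _ _ => True
  | .ne _ _ => True
  | .rel _ _ => True
  | .nrel _ _ => True
  | .dep _ _ _ => True
  | .or φ ψ => φ.DiamondFree ∧ ψ.DiamondFree
  | .and φ ψ => φ.DiamondFree ∧ ψ.DiamondFree
  | .ex _ φ => φ.DiamondFree
  | .all _ φ => φ.DiamondFree
  | .dia _ => False

/-- Assignments over `M` with domain the finite set of variables `V`. -/
abbrev Assignment (M : Type w) (V : Finset ℕ) : Type w := V → M

/-- Teams over `M` with domain `V`. -/
abbrev Team (M : Type w) (V : Finset ℕ) : Type w := Set (Assignment M V)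

/-- The assignment `s[m/x]`, whose domain is `V ∪ {x}`. -/
def Assignment.update {M : Type w} {V : Finset ℕ} (s : Assignment M V) (x : ℕ) (m : M) :
    Assignment M (insert x V) :=
  fun y => if h : y.1 = x then m else s ⟨y.1, Finset.mem_of_mem_insert_of_ne y.2 h⟩

/-- The value under `s` of a term all of whose variables belong to the domain of `s`. -/
def Assignment.value {L : FirstOrder.Language.{u, v}} {M : Type w} [L.Structure M] {V : Finset ℕ}
    (s : Assignment M V) (t : L.Term ℕ) (h : t.varFinset ⊆ V) : M :=
  (t.restrictVar fun x => (⟨x.1, h x.2⟩ : V)).realize s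

/-- The tuple of values under `s` of a tuple of terms. -/
def Assignment.values {L : FirstOrder.Language.{u, v}} {M : Type w} [L.Structure M] {V : Finset ℕ}
    (s : Assignment M V) {n : ℕ} (t : Fin n → L.Term ℕ) (h : tupleVars t ⊆ V) : Fin n → M :=
  fun i => s.value (t i) ((varFinset_subset_tupleVars t i).trans h)

/-- The relation `X(t) = {s(t) : s ∈ X}`. -/
def Team.relation {L : FirstOrder.Language.{u, v}} {M : Type w} [L.Structure M] {V : Finset ℕ}
    (X : Team M V) {n : ℕ} (t : Fin n → L.Term ℕ) (h : tupleVars t ⊆ V) : Set (Fin n → M) :=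
  {a | ∃ s ∈ X, a = s.values t h}

/-- The supplementation `X[H/x]`, where `H` maps every `s ∈ X` to a nonempty subset of `M`. -/
def Team.supplement {M : Type w} {V : Finset ℕ} (X : Team M V)
    (H : X → {A : Set M // A.Nonempty}) (x : ℕ) : Team M (insert x V) :=
  {s' | ∃ s : X, ∃ m ∈ (H s).1, s' = s.1.update x m}

/-- The duplication `X[M/x]`. -/
def Team.duplicate {M : Type w} {V : Finset ℕ} (X : Team M V) (x : ℕ) : Team M (insert x V) :=
  {s' | ∃ s ∈ X, ∃ m : M, s' = s.update x m}

/-- Satisfaction `M ⊨_X φ` of a formula `φ` by a team `X` whose domain contains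
all free variables of `φ`. -/
def Satisfies {L : FirstOrder.Language.{u, v}} {D : Set Dependency} {M : Type w} [L.Structure M] :
    (φ : TeamFormula L D) → (V : Finset ℕ) → φ.freeVars ⊆ V → Team M V → Prop
  | .eq t₁ t₂, _, h, X => ∀ s ∈ X,
      s.value t₁ (Finset.union_subset_left h) = s.value t₂ (Finset.union_subset_right h)
  | .ne t₁ t₂, _, h, X => ∀ s ∈ X,
      s.value t₁ (Finset.union_subset_left h) ≠ s.value t₂ (Finset.union_subset_right h)
  | .rel R t, _, h, X => ∀ s ∈ X, FirstOrder.Language.Structure.RelMap R (s.values t h)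
  | .nrel R t, _, h, X => ∀ s ∈ X, ¬ FirstOrder.Language.Structure.RelMap R (s.values t h)
  | .dep d _ t, _, h, X => d.Holds (X.relation t h)
  | .or φ ψ, V, h, X => ∃ Y Z : Team M V, X = Y ∪ Z ∧
      Satisfies φ V (Finset.union_subset_left h) Y ∧
      Satisfies ψ V (Finset.union_subset_right h) Z
  | .and φ ψ, V, h, X =>
      Satisfies φ V (Finset.union_subset_left h) X ∧
      Satisfies ψ V (Finset.union_subset_right h) X
  | .ex x φ, V, h, X => ∃ H : X → {A : Set M // A.Nonempty},
      Satisfies φ (insert x V) (Finset.subset_insert_iff.2 h) (X.supplement H x)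
  | .all x φ, V, h, X =>
      Satisfies φ (insert x V) (Finset.subset_insert_iff.2 h) (X.duplicate x)
  | .dia φ, V, h, X => ∃ Y : Team M V, Y ⊆ X ∧ Y.Nonempty ∧ Satisfies φ V h Y

/-- The empty assignment `ε`. -/
def emptyAssignment (M : Type w) : Assignment M ∅ :=
  fun x => absurd x.2 (Finset.notMem_empty x.1)

/-- Sentences of `FO(D, ◇)`: formulas without free variables. -/
abbrev TeamSentence (L : FirstOrder.Language.{u, v}) (D : Set Dependency) : Type (max u v) :=
  {φ : TeamFormula L D // φ.freeVars = ∅}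

/-- `M ⊨ φ`, that is, `M ⊨_{{ε}} φ`. -/
def TeamSentence.IsTrueIn {L : FirstOrder.Language.{u, v}} {D : Set Dependency} (φ : TeamSentence L D)
    (M : Type w) [L.Structure M] : Prop :=
  Satisfies φ.1 ∅ φ.2.subset ({emptyAssignment M} : Team M ∅)

end TeamLogic

/-! The diamonds are removed one at a time. A diamond only demands that a nonempty team reach its
occurrence, so it suffices to have an assignment whose route there can be enforced. Two fresh
variables `p`, `q` mark such assignments: those with `p = q` are tracing.

The translation replaces `◇φ` by `φ ∨ p ≠ q`, so tracing assignments must enter `φ`. At a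
disjunction, the disjunct without the chosen diamond is conjoined with `p ≠ q`, which sends tracing
assignments to the other side. Conjunction and `∃` need no change. Under `∀x`, an assignment spreads
over all values of `x`; `traceAll` guesses one value `c` and passes the mark, as a new pair `c = d`,
to the branch `x = c`.

Dependencies need not be closed under subteams, so tracing assignments must not disturb the rest.
`Traces` therefore requires, for completeness, that the non-tracing assignments alone reproduce the
original team, and that all tracing ones duplicate a single member `s₀`. By locality
(`TotalSat.congr`) such duplicates are harmless. For a sentence, the prefix `∀p ∀q` supplies both
kinds of assignment in any structure with two elements. Induction on `diaCount` finishes. -/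

namespace TeamLogic

open FirstOrder.Language

/-! ### Teams of total assignments, and locality -/

section TotalSemantics

variable {L : FirstOrder.Language.{u, v}} {D : Set Dependency} {M : Type w}

/-- The team `X[H/x]` of total assignments. -/
def totalSupplement (X : Set (ℕ → M)) (H : (ℕ → M) → Set M) (x : ℕ) : Set (ℕ → M) :=
  {s' | ∃ s ∈ X, ∃ m ∈ H s, s' = Function.update s x m}

/-- The team `X[M/x]` of total assignments. -/
def totalDuplicate (X : Set (ℕ → M)) (x : ℕ) : Set (ℕ → M) :=
  {s' | ∃ s ∈ X, ∃ m : M, s' = Function.update s x m}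

/-- Team semantics for teams of total assignments. -/
def TotalSat [L.Structure M] : TeamFormula L D → Set (ℕ → M) → Prop
  | .eq t₁ t₂, X => ∀ s ∈ X, t₁.realize s = t₂.realize s
  | .ne t₁ t₂, X => ∀ s ∈ X, t₁.realize s ≠ t₂.realize s
  | .rel R t, X => ∀ s ∈ X, Structure.RelMap R fun i => (t i).realize s
  | .nrel R t, X => ∀ s ∈ X, ¬ Structure.RelMap R fun i => (t i).realize s
  | .dep d _ t, X => d.Holds {a | ∃ s ∈ X, a = fun i => (t i).realize s}
  | .or φ ψ, X => ∃ Y Z, X = Y ∪ Z ∧ TotalSat φ Y ∧ TotalSat ψ Z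
  | .and φ ψ, X => TotalSat φ X ∧ TotalSat ψ X
  | .ex x φ, X => ∃ H : (ℕ → M) → Set M,
      (∀ s ∈ X, (H s).Nonempty) ∧ TotalSat φ (totalSupplement X H x)
  | .all x φ, X => TotalSat φ (totalDuplicate X x)
  | .dia φ, X => ∃ Y ⊆ X, Y.Nonempty ∧ TotalSat φ Y

/-- The restriction of a total assignment to the domain `V`. -/
def restrictTo (V : Finset ℕ) (s : ℕ → M) : Assignment M V := fun y => s y.1

theorem restrictTo_update (V : Finset ℕ) (s : ℕ → M) (x : ℕ) (m : M) :
    restrictTo (insert x V) (Function.update s x m) = (restrictTo V s).update x m := by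
  funext y
  by_cases h : y.1 = x <;> simp [restrictTo, Assignment.update, h]

theorem restrictTo_eq_iff {V : Finset ℕ} {s t : ℕ → M} :
    restrictTo V s = restrictTo V t ↔ ∀ x ∈ V, s x = t x := by
  simp [restrictTo, funext_iff]

theorem value_restrictTo [L.Structure M] {V : Finset ℕ} (s : ℕ → M) (t : L.Term ℕ)
    (h : t.varFinset ⊆ V) : (restrictTo V s).value t h = t.realize s :=
  Term.realize_restrictVar _ fun _ => rfl

theorem values_restrictTo [L.Structure M] {V : Finset ℕ} (s : ℕ → M) {n : ℕ} (t : Fin n → L.Term ℕ)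
    (h : tupleVars t ⊆ V) : (restrictTo V s).values t h = fun i => (t i).realize s :=
  funext fun i => value_restrictTo s (t i) _

theorem duplicate_image (V : Finset ℕ) (X : Set (ℕ → M)) (x : ℕ) :
    Team.duplicate (restrictTo V '' X) x = restrictTo (insert x V) '' totalDuplicate X x := by
  ext a
  constructor
  · rintro ⟨_, ⟨s, hs, rfl⟩, m, rfl⟩
    exact ⟨_, ⟨s, hs, m, rfl⟩, restrictTo_update ..⟩
  · rintro ⟨_, ⟨s, hs, m, rfl⟩, rfl⟩
    exact ⟨_, ⟨s, hs, rfl⟩, m, restrictTo_update ..⟩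

theorem image_split {α β : Type*} {f : α → β} {X : Set α} {Y Z : Set β} (h : f '' X = Y ∪ Z) :
    ∃ Y' Z', X = Y' ∪ Z' ∧ f '' Y' = Y ∧ f '' Z' = Z := by
  refine ⟨X ∩ f ⁻¹' Y, X ∩ f ⁻¹' Z, ?_, ?_, ?_⟩
  · rw [← Set.inter_union_distrib_left, ← Set.preimage_union, ← h]
    exact (Set.inter_eq_left.2 (Set.subset_preimage_image f X)).symm
  · rw [Set.image_inter_preimage, h]; simp
  · rw [Set.image_inter_preimage, h]; simp

/-- The semantics on teams with a finite domain agrees with that on total assignments. -/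
theorem satisfies_image_iff [L.Structure M] (φ : TeamFormula L D) (V : Finset ℕ)
    (h : φ.freeVars ⊆ V) (X : Set (ℕ → M)) :
    Satisfies φ V h (restrictTo V '' X) ↔ TotalSat φ X := by
  induction φ generalizing V X with
  | eq t₁ t₂ => simp [Satisfies, TotalSat, value_restrictTo]
  | ne t₁ t₂ => simp [Satisfies, TotalSat, value_restrictTo]
  | rel R t =>
    simp only [Satisfies, TotalSat, Set.forall_mem_image]
    exact forall₂_congr fun s _ => by rw [values_restrictTo s t h]
  | nrel R t =>
    simp only [Satisfies, TotalSat, Set.forall_mem_image]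
    exact forall₂_congr fun s _ => by rw [values_restrictTo s t h]
  | dep d hd t =>
    simp only [Satisfies, TotalSat, Team.relation, Set.exists_mem_image]
    have (s : ℕ → M) := values_restrictTo s t h
    simp only [this]
  | or φ ψ ihφ ihψ =>
    constructor
    · rintro ⟨Y, Z, hX, hY, hZ⟩
      obtain ⟨Y, Z, rfl, rfl, rfl⟩ := image_split hX
      exact ⟨Y, Z, rfl, (ihφ ..).1 hY, (ihψ ..).1 hZ⟩
    · rintro ⟨Y, Z, rfl, hY, hZ⟩
      exact ⟨_, _, Set.image_union .., (ihφ ..).2 hY, (ihψ ..).2 hZ⟩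
  | and φ ψ ihφ ihψ => exact and_congr (ihφ ..) (ihψ ..)
  | ex x φ ih =>
    constructor
    · rintro ⟨H, hH⟩
      refine ⟨fun s => {m | ∃ hs : s ∈ X, m ∈ (H ⟨restrictTo V s, s, hs, rfl⟩).1},
        fun s hs => ?_, ?_⟩
      · obtain ⟨m, hm⟩ := (H ⟨restrictTo V s, s, hs, rfl⟩).2
        exact ⟨m, hs, hm⟩
      · refine (ih (insert x V) (Finset.subset_insert_iff.2 h) _).1 ?_
        convert hH using 1
        ext a
        constructor
        · rintro ⟨_, ⟨s, hs, m, ⟨_, hm⟩, rfl⟩, rfl⟩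
          exact ⟨_, m, hm, restrictTo_update ..⟩
        · rintro ⟨⟨_, s, hs, rfl⟩, m, hm, rfl⟩
          exact ⟨_, ⟨s, hs, m, ⟨hs, hm⟩, rfl⟩, restrictTo_update ..⟩
    · rintro ⟨H, hne, hH⟩
      -- Several members of `X` may have the same restriction. As `H` is set-valued, their choices
      -- can be united.
      refine ⟨fun a => ⟨{m | ∃ s ∈ X, restrictTo V s = a.1 ∧ m ∈ H s}, ?_⟩, ?_⟩
      · obtain ⟨_, s, hs, rfl⟩ := a
        obtain ⟨m, hm⟩ := hne s hs
        exact ⟨m, s, hs, rfl, hm⟩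
      · convert (ih (insert x V) (Finset.subset_insert_iff.2 h) _).2 hH using 1
        ext a
        constructor
        · rintro ⟨⟨_, _⟩, m, ⟨s, hs, rfl, hm⟩, rfl⟩
          exact ⟨_, ⟨s, hs, m, hm, rfl⟩, restrictTo_update ..⟩
        · rintro ⟨_, ⟨s, hs, m, hm, rfl⟩, rfl⟩
          exact ⟨⟨_, s, hs, rfl⟩, m, ⟨s, hs, rfl, hm⟩, restrictTo_update ..⟩
  | all x φ ih =>
    simp only [Satisfies, TotalSat, duplicate_image]
    exact ih ..
  | dia φ ih =>
    constructor
    · rintro ⟨Y, hY, hne, hs⟩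
      obtain ⟨Y, hYX, rfl⟩ := Set.subset_image_iff.1 hY
      exact ⟨Y, hYX, hne.of_image, (ih ..).1 hs⟩
    · rintro ⟨Y, hY, hne, hs⟩
      exact ⟨_, Set.image_mono hY, hne.image _, (ih ..).2 hs⟩

theorem isTrueIn_iff [L.Structure M] (φ : TeamSentence L D) (s : ℕ → M) :
    φ.IsTrueIn M ↔ TotalSat φ.1 {s} := by
  rw [← satisfies_image_iff φ.1 ∅ φ.2.subset, Set.image_singleton]
  have : restrictTo ∅ s = emptyAssignment M := funext fun x => absurd x.2 (Finset.notMem_empty _)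
  rw [this]; rfl

/-- Every assignment in `X` agrees on `V` with an assignment in `Y`. -/
def Covered (V : Finset ℕ) (X Y : Set (ℕ → M)) : Prop :=
  ∀ s ∈ X, ∃ t ∈ Y, ∀ x ∈ V, s x = t x

/-- Locality: only the values of the free variables matter. -/
theorem TotalSat.congr [L.Structure M] {φ : TeamFormula L D} {V : Finset ℕ} {X Y : Set (ℕ → M)}
    (hφ : TotalSat φ X) (h : φ.freeVars ⊆ V) (hXY : Covered V X Y) (hYX : Covered V Y X) :
    TotalSat φ Y := by
  rw [← satisfies_image_iff φ V h] at hφ ⊢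
  convert hφ using 1
  ext a
  constructor
  · rintro ⟨s, hs, rfl⟩
    obtain ⟨t, ht, hst⟩ := hYX s hs
    exact ⟨t, ht, (restrictTo_eq_iff.2 hst).symm⟩
  · rintro ⟨s, hs, rfl⟩
    obtain ⟨t, ht, hst⟩ := hXY s hs
    exact ⟨t, ht, (restrictTo_eq_iff.2 hst).symm⟩

theorem totalSat_or_flat [L.Structure M] {φ ψ : TeamFormula L D} {P Q : (ℕ → M) → Prop}
    (hφ : ∀ X, TotalSat φ X ↔ ∀ s ∈ X, P s) (hψ : ∀ X, TotalSat ψ X ↔ ∀ s ∈ X, Q s)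
    (X : Set (ℕ → M)) : TotalSat (.or φ ψ) X ↔ ∀ s ∈ X, P s ∨ Q s := by
  simp only [TotalSat, hφ, hψ]
  constructor
  · rintro ⟨Y, Z, rfl, hY, hZ⟩ s (hs | hs)
    · exact .inl (hY s hs)
    · exact .inr (hZ s hs)
  · intro h
    refine ⟨{s ∈ X | P s}, {s ∈ X | Q s}, ?_, fun s hs => hs.2, fun s hs => hs.2⟩
    ext s
    have := h s
    simp only [Set.mem_union, Set.mem_ofPred_eq]
    tauto

end TotalSemantics

/-! ### Counting diamonds, and tracing assignments -/

section DiamondElimination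

variable {L : FirstOrder.Language.{u, v}} {D : Set Dependency}

/-- The variables that occur in a formula, free or bound. -/
def TeamFormula.allVars : TeamFormula L D → Finset ℕ
  | .eq t₁ t₂ => t₁.varFinset ∪ t₂.varFinset
  | .ne t₁ t₂ => t₁.varFinset ∪ t₂.varFinset
  | .rel _ t => tupleVars t
  | .nrel _ t => tupleVars t
  | .dep _ _ t => tupleVars t
  | .or φ ψ => φ.allVars ∪ ψ.allVars
  | .and φ ψ => φ.allVars ∪ ψ.allVars
  | .ex x φ => insert x φ.allVars
  | .all x φ => insert x φ.allVars
  | .dia φ => φ.allVars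

theorem TeamFormula.freeVars_subset_allVars (φ : TeamFormula L D) : φ.freeVars ⊆ φ.allVars := by
  induction φ with
  | or φ ψ ihφ ihψ => exact Finset.union_subset_union ihφ ihψ
  | and φ ψ ihφ ihψ => exact Finset.union_subset_union ihφ ihψ
  | ex x φ ih => exact ((Finset.erase_subset _ _).trans ih).trans (Finset.subset_insert _ _)
  | all x φ ih => exact ((Finset.erase_subset _ _).trans ih).trans (Finset.subset_insert _ _)
  | dia φ ih => exact ih
  | _ => exact subset_rfl

/-- The number of occurrences of `◇`. -/
def TeamFormula.diaCount : TeamFormula L D → ℕ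
  | .or φ ψ => φ.diaCount + ψ.diaCount
  | .and φ ψ => φ.diaCount + ψ.diaCount
  | .ex _ φ => φ.diaCount
  | .all _ φ => φ.diaCount
  | .dia φ => φ.diaCount + 1
  | _ => 0

theorem TeamFormula.diamondFree_of_diaCount (φ : TeamFormula L D) (h : φ.diaCount = 0) :
    φ.DiamondFree := by
  induction φ <;> simp_all [diaCount, DiamondFree]

/-- The literal `p ≠ q`. -/
abbrev varNe (p q : ℕ) : TeamFormula L D := .ne (Term.var p) (Term.var q)

/-- The literal `p = q`. -/
abbrev varEq (p q : ℕ) : TeamFormula L D := .eq (Term.var p) (Term.var q)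

/-- `θ` expresses `φ` on teams in which the assignments with `p = q` (the tracing ones) witness that
one of the occurrences of `◇` in `φ` is reached by a nonempty team. -/
structure Traces (V : Finset ℕ) (p q : ℕ) (φ θ : TeamFormula L D) (M : Type w) [L.Structure M] :
    Prop where
  sound : ∀ X : Set (ℕ → M), TotalSat θ X → (∃ s ∈ X, s p = s q) → TotalSat φ X
  -- `s₀` is a member of `X` that leads to the chosen diamond. It is fixed before `X'`, so that it
  -- depends only on how `φ` is satisfied.
  complete : ∀ X : Set (ℕ → M), TotalSat φ X → ∃ s₀ ∈ X, ∀ X' : Set (ℕ → M), Covered V X' X →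
    Covered V X {s ∈ X' | s p ≠ s q} → (∀ s ∈ X', s p = s q → ∀ x ∈ V, s x = s₀ x) → TotalSat θ X'

theorem Covered.mono_right {M : Type w} {V : Finset ℕ} {X Y Z : Set (ℕ → M)} (h : Covered V X Y)
    (hYZ : Y ⊆ Z) : Covered V X Z := fun s hs =>
  let ⟨t, ht, hst⟩ := h s hs
  ⟨t, hYZ ht, hst⟩

/-! ### The translation, connective by connective -/

section Traces

variable {M : Type w} [L.Structure M] {V : Finset ℕ} {p q : ℕ}

/-- A tracing assignment fails `p ≠ q`, so the team that satisfies `φ` contains it and is nonempty.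
-/
theorem Traces.dia {φ : TeamFormula L D} (h : φ.freeVars ⊆ V) :
    Traces V p q (.dia φ) (.or φ (varNe p q)) M where
  sound := by
    rintro _ ⟨Y, Z, rfl, hY, hZ⟩ ⟨s, hs, hpq⟩
    refine ⟨Y, Set.subset_union_left, ⟨s, hs.resolve_right fun hsZ => hZ s hsZ hpq⟩, hY⟩
  complete := by
    rintro X ⟨Y, hYX, ⟨s₀, hs₀⟩, hY⟩
    refine ⟨s₀, hYX hs₀, fun X' h₁ h₂ h₃ => ⟨{s ∈ X' | ∃ t ∈ Y, ∀ x ∈ V, s x = t x},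
      {s ∈ X' | s p ≠ s q}, ?_, ?_, fun s hs => hs.2⟩⟩
    · ext s
      refine ⟨fun hs => ?_, fun hs => hs.elim And.left And.left⟩
      by_cases hpq : s p = s q
      · exact .inl ⟨hs, s₀, hs₀, h₃ s hs hpq⟩
      · exact .inr ⟨hs, hpq⟩
    · refine hY.congr h (fun s hs => ?_) fun s hs => hs.2
      obtain ⟨t, ht, hst⟩ := h₂ s (hYX hs)
      exact ⟨t, ⟨ht.1, s, hs, fun x hx => (hst x hx).symm⟩, hst⟩

theorem Traces.and_left {φ ψ θ : TeamFormula L D} (hφ : Traces V p q φ θ M)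
    (h : ψ.freeVars ⊆ V) : Traces V p q (.and φ ψ) (.and θ ψ) M where
  sound := fun X hX ht => ⟨hφ.sound X hX.1 ht, hX.2⟩
  complete := by
    rintro X ⟨hX, hX'⟩
    obtain ⟨s₀, hs₀, H⟩ := hφ.complete X hX
    exact ⟨s₀, hs₀, fun X' h₁ h₂ h₃ =>
      ⟨H X' h₁ h₂ h₃, hX'.congr h (h₂.mono_right (Set.sep_subset _ _)) h₁⟩⟩

theorem Traces.and_right {φ ψ θ : TeamFormula L D} (hφ : Traces V p q φ θ M)
    (h : ψ.freeVars ⊆ V) : Traces V p q (.and ψ φ) (.and ψ θ) M where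
  sound := fun X hX ht => ⟨hX.1, hφ.sound X hX.2 ht⟩
  complete := fun X hX =>
    let ⟨s₀, hs₀, H⟩ := (hφ.and_left h).complete X hX.symm
    ⟨s₀, hs₀, fun X' h₁ h₂ h₃ => (H X' h₁ h₂ h₃).symm⟩

theorem totalSat_or_comm {φ ψ : TeamFormula L D} {X : Set (ℕ → M)} :
    TotalSat (.or φ ψ) X ↔ TotalSat (.or ψ φ) X := by
  constructor <;> rintro ⟨Y, Z, hX, hY, hZ⟩ <;> exact ⟨Z, Y, hX.trans (Set.union_comm ..), hZ, hY⟩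

/-- The guard `p ≠ q` on `ψ` forces tracing assignments into the disjunct that contains the diamond.
-/
theorem Traces.or_left {φ ψ θ : TeamFormula L D} (hφ : Traces V p q φ θ M)
    (h : ψ.freeVars ⊆ V) : Traces V p q (.or φ ψ) (.or θ (.and (varNe p q) ψ)) M where
  sound := by
    rintro _ ⟨Y, Z, rfl, hY, hZ, hZ'⟩ ⟨s, hs, hpq⟩
    exact ⟨Y, Z, rfl, hφ.sound Y hY ⟨s, hs.resolve_right fun hsZ => hZ s hsZ hpq, hpq⟩, hZ'⟩
  complete := by
    rintro _ ⟨Y, Z, rfl, hY, hZ⟩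
    obtain ⟨s₀, hs₀, H⟩ := hφ.complete Y hY
    -- Tracing assignments copy `s₀ ∈ Y` and go left. Non-tracing copies of members of `Y ∩ Z` go to
    -- both sides, so each side is fully reproduced.
    refine ⟨s₀, .inl hs₀, fun X' h₁ h₂ h₃ => ⟨{s ∈ X' | ∃ t ∈ Y, ∀ x ∈ V, s x = t x},
      {s ∈ X' | s p ≠ s q ∧ ∃ t ∈ Z, ∀ x ∈ V, s x = t x}, ?_, ?_, fun s hs => hs.2.1, ?_⟩⟩
    · ext s
      refine ⟨fun hs => ?_, fun hs => hs.elim And.left And.left⟩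
      by_cases hpq : s p = s q
      · exact .inl ⟨hs, s₀, hs₀, h₃ s hs hpq⟩
      · obtain ⟨t, ht | ht, hst⟩ := h₁ s hs
        · exact .inl ⟨hs, t, ht, hst⟩
        · exact .inr ⟨hs, hpq, t, ht, hst⟩
    · refine H _ (fun s hs => hs.2) (fun s hs => ?_) fun s hs => h₃ s hs.1
      obtain ⟨t, ht, hst⟩ := h₂ s (.inl hs)
      exact ⟨t, ⟨⟨ht.1, s, hs, fun x hx => (hst x hx).symm⟩, ht.2⟩, hst⟩
    · refine hZ.congr h (fun s hs => ?_) fun s hs => hs.2.2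
      obtain ⟨t, ht, hst⟩ := h₂ s (.inr hs)
      exact ⟨t, ⟨ht.1, ht.2, s, hs, fun x hx => (hst x hx).symm⟩, hst⟩

theorem Traces.or_right {φ ψ θ : TeamFormula L D} (hφ : Traces V p q φ θ M)
    (h : ψ.freeVars ⊆ V) : Traces V p q (.or ψ φ) (.or θ (.and (varNe p q) ψ)) M where
  sound := fun X hX ht => totalSat_or_comm.1 ((hφ.or_left h).sound X hX ht)
  complete := fun X hX => (hφ.or_left h).complete X (totalSat_or_comm.1 hX)

theorem update_agree {s t : ℕ → M} (h : ∀ y ∈ V, s y = t y) (x : ℕ) (m : M) :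
    ∀ y ∈ V, Function.update s x m y = Function.update t x m y := by
  intro y hy
  by_cases hyx : y = x <;> simp [hyx, h y hy]

theorem Traces.ex {φ θ : TeamFormula L D} (hφ : Traces V p q φ θ M) {x : ℕ} (hp : p ≠ x)
    (hq : q ≠ x) : Traces V p q (.ex x φ) (.ex x θ) M where
  sound := by
    rintro X ⟨H, hne, hH⟩ ⟨s, hs, hpq⟩
    obtain ⟨m, hm⟩ := hne s hs
    exact ⟨H, hne, hφ.sound _ hH ⟨_, ⟨s, hs, m, hm, rfl⟩, by simpa [hp, hq] using hpq⟩⟩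
  complete := by
    rintro X ⟨H, hne, hH⟩
    obtain ⟨_, ⟨t₀, ht₀, m₀, hm₀, rfl⟩, hs₀⟩ := hφ.complete _ hH
    -- Tracing assignments take only `m₀`, to remain copies of one assignment. The others take every
    -- value allowed by `H`, to reproduce the whole supplement.
    refine ⟨t₀, ht₀, fun X' h₁ h₂ h₃ => ⟨fun s =>
      {m | (s p = s q ∧ m = m₀) ∨ (s p ≠ s q ∧ ∃ t ∈ X, (∀ y ∈ V, s y = t y) ∧ m ∈ H t)},
      fun s hs => ?_, hs₀ _ ?_ ?_ ?_⟩⟩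
    · by_cases hpq : s p = s q
      · exact ⟨m₀, .inl ⟨hpq, rfl⟩⟩
      · obtain ⟨t, ht, hst⟩ := h₁ s hs
        obtain ⟨m, hm⟩ := hne t ht
        exact ⟨m, .inr ⟨hpq, t, ht, hst, hm⟩⟩
    · rintro _ ⟨s, hs, m, ⟨hpq, rfl⟩ | ⟨hpq, t, ht, hst, hm⟩, rfl⟩
      · exact ⟨_, ⟨t₀, ht₀, m, hm₀, rfl⟩, update_agree (h₃ s hs hpq) x m⟩
      · exact ⟨_, ⟨t, ht, m, hm, rfl⟩, update_agree hst x m⟩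
    · rintro _ ⟨t, ht, m, hm, rfl⟩
      obtain ⟨s, hs, hst⟩ := h₂ t ht
      exact ⟨_, ⟨⟨s, hs.1, m, .inr ⟨hs.2, t, ht, fun y hy => (hst y hy).symm, hm⟩, rfl⟩,
        by simpa [hp, hq] using hs.2⟩, update_agree hst x m⟩
    · rintro _ ⟨s, hs, m, ⟨hpq, rfl⟩ | ⟨hpq, -⟩, rfl⟩ hpq'
      · exact update_agree (h₃ s hs hpq) x m
      · exact absurd (by simpa [hp, hq] using hpq') hpq

/-- The translation of `∀ x φ`, where `θ` is the translation of `φ` that uses `c = d` to mark the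
tracing assignments. -/
def traceAll (p q c d x : ℕ) (θ : TeamFormula L D) : TeamFormula L D :=
  .ex c (.all x (.ex d (.and (.or (varNe p q) (.or (varNe x c) (varEq c d))) θ)))

theorem totalSat_guard {x c d : ℕ} (X : Set (ℕ → M)) :
    TotalSat (.or (varNe p q) (.or (varNe x c) (varEq c d)) : TeamFormula L D) X ↔
      ∀ s ∈ X, s p ≠ s q ∨ s x ≠ s c ∨ s c = s d :=
  totalSat_or_flat (fun _ => Iff.rfl)
    (totalSat_or_flat (fun _ => Iff.rfl) (fun _ => Iff.rfl)) X

theorem update_fresh_agree {s t : ℕ → M} {c d x : ℕ} (hc : c ∉ V) (hd : d ∉ V)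
    (h : ∀ y ∈ V, s y = t y) (a m e : M) :
    ∀ y ∈ V, Function.update (Function.update (Function.update s c a) x m) d e y =
      Function.update t x m y := by
  intro y hy
  have hyd : y ≠ d := fun h => hd (h ▸ hy)
  have hyc : y ≠ c := fun h => hc (h ▸ hy)
  by_cases hyx : y = x
  · subst hyx; simp [hyd]
  · simp [hyd, hyc, hyx, h y hy]

/-- Keeping the mark `p = q` would make every value of `x` tracing, and the tracing assignments
would no longer copy a single one; hence the new pair `c`, `d`. -/
theorem Traces.all [Nontrivial M] {φ θ : TeamFormula L D} {c d x : ℕ} (hφ : Traces V c d φ θ M)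
    (hfree : φ.freeVars ⊆ V) (hx : x ∈ V) (hp : p ∉ V) (hq : q ∉ V) (hc : c ∉ V) (hd : d ∉ V)
    (hcd : c ≠ d) (hpc : p ≠ c) (hpd : p ≠ d) (hqc : q ≠ c) (hqd : q ≠ d) :
    Traces V p q (.all x φ) (traceAll p q c d x θ) M := by
  have hpx : p ≠ x := fun h => hp (h ▸ hx)
  have hqx : q ≠ x := fun h => hq (h ▸ hx)
  have hcx : c ≠ x := fun h => hc (h ▸ hx)
  have hdx : d ≠ x := fun h => hd (h ▸ hx)
  constructor
  · rintro X ⟨C, hC, E, hE, hG, hθ⟩ ⟨s, hs, hpq⟩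
    rw [totalSat_guard] at hG
    refine (hφ.sound _ hθ ?_).congr hfree ?_ ?_
    · obtain ⟨a, ha⟩ := hC s hs
      obtain ⟨e, he⟩ := hE _ ⟨_, ⟨s, hs, a, ha, rfl⟩, a, rfl⟩
      refine ⟨_, ⟨_, ⟨_, ⟨s, hs, a, ha, rfl⟩, a, rfl⟩, e, he, rfl⟩, ?_⟩
      -- On the branch `x = c = a` of a tracing assignment the first two disjuncts of the guard
      -- fail, which leaves `c = d`.
      have := hG _ ⟨_, ⟨_, ⟨s, hs, a, ha, rfl⟩, a, rfl⟩, e, he, rfl⟩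
      simpa [hpc, hpd, hqc, hqd, hpx, hqx, hcx, hcd, hdx.symm, hpq] using this
    · rintro _ ⟨_, ⟨_, ⟨s, hs, a, ha, rfl⟩, m, rfl⟩, e, he, rfl⟩
      exact ⟨_, ⟨s, hs, m, rfl⟩, update_fresh_agree hc hd (fun _ _ => rfl) a m e⟩
    · rintro _ ⟨s, hs, m, rfl⟩
      obtain ⟨a, ha⟩ := hC s hs
      obtain ⟨e, he⟩ := hE _ ⟨_, ⟨s, hs, a, ha, rfl⟩, m, rfl⟩
      exact ⟨_, ⟨_, ⟨_, ⟨s, hs, a, ha, rfl⟩, m, rfl⟩, e, he, rfl⟩, fun y hy =>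
        (update_fresh_agree hc hd (fun _ _ => rfl) a m e y hy).symm⟩
  · intro X hX
    obtain ⟨_, ⟨t₀, ht₀, m₀, rfl⟩, hs₀⟩ := hφ.complete _ hX
    -- `c` is the value of `x` in the tracing member `s₀`. `d` takes all values that make `c = d`
    -- hold exactly when the guard demands it; a second element of `M` is needed when it must fail.
    refine ⟨t₀, ht₀, fun X' h₁ h₂ h₃ => ⟨fun _ => {m₀}, fun _ _ => Set.singleton_nonempty _,
      fun s => {e | s c = e ↔ s p = s q ∧ s x = s c}, fun s _ => ?_, ?_, hs₀ _ ?_ ?_ ?_⟩⟩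
    · by_cases h : s p = s q ∧ s x = s c
      · exact ⟨s c, by simp [h]⟩
      · obtain ⟨e, he⟩ := exists_ne (s c)
        exact ⟨e, iff_of_false he.symm h⟩
    · rw [totalSat_guard]
      rintro _ ⟨_, ⟨_, ⟨s, hs, _, rfl, rfl⟩, m, rfl⟩, e, he, rfl⟩
      simp [hpc, hpd, hqc, hqd, hpx, hqx, hcx, hcd, hdx.symm] at he ⊢
      tauto
    · rintro _ ⟨_, ⟨_, ⟨s, hs, a, ha, rfl⟩, m, rfl⟩, e, he, rfl⟩
      obtain ⟨t, ht, hst⟩ := h₁ s hs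
      exact ⟨_, ⟨t, ht, m, rfl⟩, update_fresh_agree hc hd hst a m e⟩
    · rintro _ ⟨t, ht, m, rfl⟩
      obtain ⟨s, ⟨hs, hpq⟩, hst⟩ := h₂ t ht
      obtain ⟨e, he⟩ := exists_ne m₀
      refine ⟨_, ⟨⟨_, ⟨_, ⟨s, hs, m₀, rfl, rfl⟩, m, rfl⟩, e, ?_, rfl⟩, ?_⟩, fun y hy =>
        (update_fresh_agree hc hd (fun y hy => (hst y hy).symm) m₀ m e y hy).symm⟩
      · simp [hpc, hqc, hpx, hqx, hcx, hpq, he.symm]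
      · simp [hcx, hcd, he.symm]
    · rintro _ ⟨_, ⟨_, ⟨s, hs, _, rfl, rfl⟩, m, rfl⟩, e, he, rfl⟩ h
      simp [hpc, hqc, hpx, hqx, hcx, hcd] at he h
      obtain ⟨hpq, rfl⟩ := he.1 h
      exact update_fresh_agree hc hd (h₃ s hs hpq) _ _ _

end Traces

/-! ### Removing one diamond, then all of them -/

/-- One occurrence of `◇` can be traded for tracing assignments. -/
theorem exists_traces (φ : TeamFormula L D) (hφ : φ.diaCount ≠ 0) (V : Finset ℕ)
    (hV : φ.allVars ⊆ V) (p q : ℕ) (hp : p ∉ V) (hq : q ∉ V) :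
    ∃ θ : TeamFormula L D, θ.diaCount < φ.diaCount ∧ θ.freeVars ⊆ φ.freeVars ∪ {p, q} ∧
      ∀ (M : Type w) [L.Structure M] [Nontrivial M], Traces V p q φ θ M := by
  induction φ generalizing p q with
  | or φ ψ ihφ ihψ =>
    have hVφ := Finset.union_subset_left hV
    have hVψ := Finset.union_subset_right hV
    by_cases h : φ.diaCount = 0
    · have hψ : ψ.diaCount ≠ 0 := by simpa [TeamFormula.diaCount, h] using hφ
      obtain ⟨θ, hlt, hfv, H⟩ := ihψ hψ hVψ p q hp hq
      refine ⟨_, ?_, ?_, fun M _ _ => (H M).or_right (φ.freeVars_subset_allVars.trans hVφ)⟩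
      · simp only [TeamFormula.diaCount]; omega
      · simp only [TeamFormula.freeVars, Term.varFinset]; grind
    · obtain ⟨θ, hlt, hfv, H⟩ := ihφ h hVφ p q hp hq
      refine ⟨_, ?_, ?_, fun M _ _ => (H M).or_left (ψ.freeVars_subset_allVars.trans hVψ)⟩
      · simp only [TeamFormula.diaCount]; omega
      · simp only [TeamFormula.freeVars, Term.varFinset]; grind
  | and φ ψ ihφ ihψ =>
    have hVφ := Finset.union_subset_left hV
    have hVψ := Finset.union_subset_right hV
    by_cases h : φ.diaCount = 0
    · have hψ : ψ.diaCount ≠ 0 := by simpa [TeamFormula.diaCount, h] using hφ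
      obtain ⟨θ, hlt, hfv, H⟩ := ihψ hψ hVψ p q hp hq
      refine ⟨_, ?_, ?_, fun M _ _ => (H M).and_right (φ.freeVars_subset_allVars.trans hVφ)⟩
      · simp only [TeamFormula.diaCount]; omega
      · simp only [TeamFormula.freeVars]; grind
    · obtain ⟨θ, hlt, hfv, H⟩ := ihφ h hVφ p q hp hq
      refine ⟨_, ?_, ?_, fun M _ _ => (H M).and_left (ψ.freeVars_subset_allVars.trans hVψ)⟩
      · simp only [TeamFormula.diaCount]; omega
      · simp only [TeamFormula.freeVars]; grind
  | ex x φ ih =>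
    obtain ⟨hx, hVφ⟩ := Finset.insert_subset_iff.1 hV
    obtain ⟨θ, hlt, hfv, H⟩ := ih hφ hVφ p q hp hq
    refine ⟨.ex x θ, hlt, ?_, fun M _ _ =>
      (H M).ex (fun h => hp (h ▸ hx)) fun h => hq (h ▸ hx)⟩
    simp only [TeamFormula.freeVars]; grind
  | all x φ ih =>
    obtain ⟨hx, hVφ⟩ := Finset.insert_subset_iff.1 hV
    obtain ⟨c, hc⟩ := Infinite.exists_notMem_finset (V ∪ {p, q})
    obtain ⟨d, hd⟩ := Infinite.exists_notMem_finset (V ∪ {p, q, c})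
    simp only [Finset.mem_union, Finset.mem_insert, Finset.mem_singleton, not_or] at hc hd
    obtain ⟨θ, hlt, hfv, H⟩ := ih hφ hVφ c d hc.1 hd.1
    refine ⟨traceAll p q c d x θ, ?_, ?_, fun M _ _ =>
      (H M).all (φ.freeVars_subset_allVars.trans hVφ) hx hp hq hc.1 hd.1 (Ne.symm hd.2.2.2)
        (Ne.symm hc.2.1) (Ne.symm hd.2.1) (Ne.symm hc.2.2) (Ne.symm hd.2.2.1)⟩
    · simpa [traceAll, TeamFormula.diaCount] using hlt
    · intro y hy
      have := @hfv y
      simp only [traceAll, TeamFormula.freeVars, Term.varFinset, Finset.mem_erase, Finset.mem_union,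
        Finset.mem_singleton, Finset.mem_insert] at hy this ⊢
      tauto
  | dia φ ih =>
    refine ⟨_, ?_, ?_, fun M _ _ => Traces.dia (φ.freeVars_subset_allVars.trans hV)⟩
    · simp [TeamFormula.diaCount]
    · simp only [TeamFormula.freeVars, Term.varFinset]; grind
  | _ => exact absurd rfl hφ

/-- Every sentence with an occurrence of `◇` is equivalent to one with fewer occurrences. -/
theorem exists_equiv_diaCount_lt (φ : TeamSentence L D) (hφ : φ.1.diaCount ≠ 0) :
    ∃ φ' : TeamSentence L D, φ'.1.diaCount < φ.1.diaCount ∧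
      ∀ (M : Type w) [L.Structure M] [Nontrivial M], φ.IsTrueIn M ↔ φ'.IsTrueIn M := by
  obtain ⟨p, hp⟩ := Infinite.exists_notMem_finset φ.1.allVars
  obtain ⟨q, hq⟩ := Infinite.exists_notMem_finset (insert p φ.1.allVars)
  rw [Finset.mem_insert, not_or] at hq
  obtain ⟨hqp, hq⟩ := hq
  obtain ⟨θ, hlt, hfv, H⟩ := exists_traces.{u, v, w} φ.1 hφ _ subset_rfl p q hp hq
  -- The team for `θ` has all pairs of values for `p`, `q`: equal pairs trace, unequal ones
  -- reproduce the initial team.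
  refine ⟨⟨.all p (.all q θ), ?_⟩, hlt, fun M _ _ => ?_⟩
  · rw [φ.2] at hfv
    simp only [TeamFormula.freeVars]; grind
  obtain ⟨a⟩ := (inferInstance : Nonempty M)
  rw [isTrueIn_iff φ fun _ => a, isTrueIn_iff _ fun _ => a]
  have hcov : Covered φ.1.allVars (totalDuplicate (totalDuplicate {fun _ => a} p) q)
      {fun _ => a} := by
    rintro _ ⟨_, ⟨_, rfl, m, rfl⟩, m', rfl⟩
    refine ⟨_, rfl, fun y hy => ?_⟩
    have h₁ : y ≠ p := fun h => hp (h ▸ hy)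
    have h₂ : y ≠ q := fun h => hq (h ▸ hy)
    simp [h₁, h₂]
  constructor
  · intro h
    obtain ⟨_, rfl, hs⟩ := (H M).complete _ h
    refine hs _ hcov ?_ fun s hs' _ => ?_
    · rintro _ rfl
      obtain ⟨b, hb⟩ := exists_ne a
      refine ⟨_, ⟨⟨_, ⟨_, rfl, a, rfl⟩, b, rfl⟩, ?_⟩, fun y hy => ?_⟩
      · simp [Ne.symm hqp, hb.symm]
      · have h₂ : y ≠ q := fun h => hq (h ▸ hy)
        simp [h₂]
    · obtain ⟨_, rfl, h⟩ := hcov s hs'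
      exact h
  · intro h
    refine ((H M).sound _ h ?_).congr φ.1.freeVars_subset_allVars hcov ?_
    · exact ⟨_, ⟨_, ⟨_, rfl, a, rfl⟩, a, rfl⟩, by simp [Ne.symm hqp]⟩
    · rintro _ rfl
      exact ⟨_, ⟨_, ⟨_, rfl, a, rfl⟩, a, rfl⟩, fun y _ => by simp⟩

end DiamondElimination

theorem exists_equiv_diamondFree {L : FirstOrder.Language.{u, v}} {D : Set Dependency} (n : ℕ)
    (φ : TeamSentence L D) (hn : φ.1.diaCount = n) :
    ∃ φ' : TeamSentence L D, φ'.1.DiamondFree ∧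
      ∀ (M : Type w) [L.Structure M] [Nontrivial M], φ.IsTrueIn M ↔ φ'.IsTrueIn M := by
  induction n using Nat.strong_induction_on generalizing φ with
  | _ n ih =>
    by_cases h : φ.1.diaCount = 0
    · exact ⟨φ, φ.1.diamondFree_of_diaCount h, fun _ _ _ => Iff.rfl⟩
    · obtain ⟨φ₁, hlt, h₁⟩ := exists_equiv_diaCount_lt.{u, v, w} φ h
      obtain ⟨φ₂, hfree, h₂⟩ := ih _ (hn ▸ hlt) φ₁ rfl
      exact ⟨φ₂, hfree, fun M _ _ => (h₁ M).trans (h₂ M)⟩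

end TeamLogic

theorem mainTheorem5 (L : FirstOrder.Language.{u, v}) (D : Set TeamLogic.Dependency)
    (φ : TeamLogic.TeamSentence L D) :
    ∃ φ' : TeamLogic.TeamSentence L D, φ'.1.DiamondFree ∧
      ∀ (M : Type w) [L.Structure M] [Nontrivial M], φ.IsTrueIn M ↔ φ'.IsTrueIn M :=
  TeamLogic.exists_equiv_diamondFree _ φ rfl
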